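/- Let $R$ be an integral domain (commutative). \textbf{Finiteness properties.} A monoid $M$ is of type $\mathsf{FP}_n(R)$ if the trivial left $RM$-module $R$ has a resolution $C_\bullet$ by projective left $RM$-modules with $C_i$ finitely generated for all $i\leqslant n$. Let $G$ be a group. A character is a homomorphism $\varphi\colon G\to\mathbb{Z}$, that is, an element of $H^1(G;\mathbb{Z})$. Put $G_\varphi=\{g\in G\mid \varphi(g)\geqslant 0\}$, a monoid. A non-trivial character $\varphi$ is $\mathsf{FP}_n(R)$-semi-fibred if $G_\varphi$ or $G_{-\varphi}$ is of type $\mathsf{FP}_n(R)$. \textbf{Twisted Alexander modules.} Let $\varphi\colon G\to\mathbb{Z}$ be a character and $\alpha\colon G\twoheadrightarrow Q$ an epimorphism onto a finite group. Let $RQ[t^{\pm1}]$ be the right $RG$-module in which $g\in G$ acts by $x\cdot g=x\,t^{\varphi(g)}\alpha(g)$. The homology group $H_i(G;RQ[t^{\pm1}])$ is an $R[t^{\pm1}]$-module through multiplication on the coefficients. We say that the $i$th Alexander polynomial of $\varphi$ twisted by $\alpha$ does not vanish (over $R$) if this module has rank $0$, i.e. if $\mathrm{Frac}(R[t^{\pm1}])\otimes_{R[t^{\pm1}]}H_i(G;RQ[t^{\pm1}])=0$.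 We say that the $i$th twisted Alexander polynomials of $\varphi$ do not vanish if this holds for every such $\alpha$. \textbf{The class $\mathsf{TAP}_n(R)$.} A group $G$ is in $\mathsf{TAP}_n(R)$ if it is of type $\mathsf{FP}_n(R)$ and every non-trivial character $\varphi\colon G\to\mathbb{Z}$ satisfies: $\varphi$ is $\mathsf{FP}_n(R)$-semi-fibred if and only if for each $0\leqslant i\leqslant n$ its $i$th twisted Alexander polynomials do not vanish. \textbf{Proposition.} Let $G_1$ and $G_2$ be finitely generated groups. If $G_1$ and $G_2$ are in $\mathsf{TAP}_1(R)$, then $G_1\times G_2$ is in $\mathsf{TAP}_1(R)$. -/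

import Mathlib

open scoped LaurentPolynomial TensorProduct

universe u

namespace TAP

/-- A monoid `M` is of type `FP_n(R)`: the trivial left `R[M]`-module `R` has a resolution
`⋯ → C₂ → C₁ → C₀ → R → 0` by projective left `R[M]`-modules such that `C_i` is finitely
generated for every `i ≤ n`. -/
def IsFP (R : Type u) [CommRing R] (M : Type u) [Monoid M] (n : ℕ) : Prop :=
  ∃ (C : ℕ → ModuleCat.{u} (MonoidAlgebra R M))
    (d : ∀ i, C (i + 1) →ₗ[MonoidAlgebra R M] C i)
    (ε : C 0 →ₗ[MonoidAlgebra R M] (Representation.trivial R M R).asModule),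
    Function.Surjective ε ∧
    Function.Exact (d 0) ε ∧
    (∀ i, Function.Exact (d (i + 1)) (d i)) ∧
    (∀ i, Module.Projective (MonoidAlgebra R M) (C i)) ∧
    ∀ i, i ≤ n → Module.Finite (MonoidAlgebra R M) (C i)

section Characters

variable {G : Type u} [Group G]

/-- The monoid `G_φ = {g ∈ G | φ(g) ≥ 0}` of an integral character `φ : G → ℤ`.
Integral characters, i.e. classes in `H¹(G; ℤ)`, are homomorphisms `G →* Multiplicative ℤ`;
the zero character is `1` and the character `-φ` is `φ⁻¹`. -/
def nonnegMonoid (φ : G →* Multiplicative ℤ) : Submonoid G where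
  carrier := {g | 0 ≤ (φ g).toAdd}
  one_mem' := by simp
  mul_mem' {a b} ha hb := by
    simp only [Set.mem_ofPred_eq, map_mul, toAdd_mul] at *
    exact add_nonneg ha hb

/-- The integral characters in the `n`-th (homological) Bieri–Neumann–Strebel invariant
`Σⁿ(G; R)`: the non-trivial characters `φ` whose monoid `G_φ` is of type `FP_n(R)`. -/
def bnsInvariant (R : Type u) [CommRing R] (G : Type u) [Group G] (n : ℕ) :
    Set (G →* Multiplicative ℤ) :=
  {φ | φ ≠ 1 ∧ IsFP R (nonnegMonoid φ) n}

/-- A character is `FP_n(R)`-semi-fibred if it lies in `Σⁿ(G; R) ∪ -Σⁿ(G; R)`. -/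
def IsSemiFibred (R : Type u) [CommRing R] (n : ℕ) (φ : G →* Multiplicative ℤ) : Prop :=
  φ ∈ bnsInvariant R G n ∨ φ⁻¹ ∈ bnsInvariant R G n

/-- The coefficient module `RQ[t^{±1}]`, realised as the group ring of `Q` over `R[t^{±1}]`.
The right action of `G` is `x · g = x t^{φ(g)} α(g)`; it is recorded as the left action
`g ↦ (x ↦ x · g⁻¹)`, which is the convention of `groupHomology` for coefficients. It commutes with
the multiplication by elements of `R[t^{±1}]`, so that it is a representation over
`R[t^{±1}]`. -/
noncomputable def twistedRep (R : Type u) [CommRing R] {Q : Type u} [Group Q]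
    (φ : G →* Multiplicative ℤ) (α : G →* Q) :
    Representation R[T;T⁻¹] G (MonoidAlgebra R[T;T⁻¹] Q) where
  toFun g := LinearMap.mulRight R[T;T⁻¹]
    (MonoidAlgebra.single (α g⁻¹) (LaurentPolynomial.T (φ g⁻¹).toAdd))
  map_one' := by
    ext x
    simp [← MonoidAlgebra.one_def]
  map_mul' g h := by
    refine LinearMap.ext fun x => ?_
    simp only [LinearMap.mulRight_apply, Module.End.mul_apply, mul_assoc,
      MonoidAlgebra.single_mul_single, mul_inv_rev, map_mul, toAdd_mul, LaurentPolynomial.T_add]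

/-- The `n`-th twisted Alexander module `H_n(G; RQ[t^{±1}])` of `φ` and `α`, with its
`R[t^{±1}]`-module structure. (The complex of inhomogeneous chains that computes it does not depend
on the base ring; over `R[t^{±1}]` it carries the module structure induced from the
coefficients.) -/
noncomputable def alexanderModule (R : Type u) [CommRing R] {Q : Type u} [Group Q]
    (φ : G →* Multiplicative ℤ) (α : G →* Q) (n : ℕ) : ModuleCat.{u} R[T;T⁻¹] :=
  groupHomology (Rep.of (twistedRep R φ α)) n

/-- The rank of a module `M` over a domain `S`: the dimension of `Frac(S) ⊗_S M`
over `Frac(S)`. -/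
noncomputable def fractionRank (S : Type u) [CommRing S] (M : Type u) [AddCommGroup M]
    [Module S M] : Cardinal.{u} :=
  Module.rank (FractionRing S) (FractionRing S ⊗[S] M)

/-- The `n`-th Alexander polynomial of `φ` twisted by `α` does not vanish: the twisted Alexander
module has rank `0` over `R[t^{±1}]`. -/
def NonvanishingAlexander (R : Type u) [CommRing R] {Q : Type u} [Group Q]
    (φ : G →* Multiplicative ℤ) (α : G →* Q) (n : ℕ) : Prop :=
  fractionRank R[T;T⁻¹] (alexanderModule R φ α n) = 0

/-- `φ` has non-vanishing `n`-th twisted Alexander polynomials: this holds for every finite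
quotient `α : G ↠ Q`. -/
def NonvanishingTwistedAlexander (R : Type u) [CommRing R]
    (φ : G →* Multiplicative ℤ) (n : ℕ) : Prop :=
  ∀ (Q : Type u) [Group Q] [Finite Q] (α : G →* Q), Function.Surjective α →
    NonvanishingAlexander R φ α n

end Characters

/-- The class `TAP_n(R)`: groups of type `FP_n(R)` in which a non-trivial integral character is
`FP_n(R)`-semi-fibred if and only if its `i`-th twisted Alexander polynomials do not vanish for
each `i ≤ n`. -/
def IsTAP (R : Type u) [CommRing R] (G : Type u) [Group G] (n : ℕ) : Prop :=
  IsFP R G n ∧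
  ∀ φ : G →* Multiplicative ℤ, φ ≠ 1 →
    (IsSemiFibred R n φ ↔ ∀ i, i ≤ n → NonvanishingTwistedAlexander R φ i)

end TAP

/-! A non-trivial character φ of G₁ × G₂ either vanishes on one factor or is non-trivial on both. If
it vanishes on one factor, it is the pullback of a character ψ of the other, and both conditions for
φ are equivalent to those for ψ, so the hypothesis on that factor applies. On the geometric side,
G_φ is the product of the monoid of ψ with a finitely generated group (`isSemiFibred_comp_iff`); on
the homological side see `nonvanishingTwistedAlexander_one_comp_iff`. If it is non-trivial on both,
both conditions hold outright. An element of positive height in one factor commutes with the other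
factor, which allows every element of G_φ to be contracted to 1 by finitely many kinds of moves
inside G_φ (`isFP_one_nonnegMonoid_of_commute`). An element of one factor with trivial image in Q
and non-zero height acts on the coefficients as a scalar t^n ≠ 1 and commutes with the other factor,
which makes twisted cocycles coboundaries (`nonvanishingTwistedAlexander_one_of_commute`). Two
translations make this elementary: FP_1 becomes finite generation of the augmentation ideal
(`isFP_one_iff`), and torsion of H_1 becomes vanishing of H^1 with coefficients in Frac(R[t^{±1}]),
which is an injective module (`nonvanishingAlexander_one_iff`). Degree 0 is automatic. -/

namespace TAP

/-! ### Resolutions by iterated projective covers -/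

section Resolution

variable {A : Type u} [Ring A]

/-- Every module is a quotient of a free module, which is finite if the module is. -/
theorem exists_projective_cover (X : ModuleCat.{u} A) :
    ∃ (P : ModuleCat.{u} A) (f : P →ₗ[A] X), Function.Surjective f ∧ Module.Projective A P ∧
      (Module.Finite A X → Module.Finite A P) := by
  by_cases hX : Module.Finite A X
  · obtain ⟨n, f, hf⟩ := Module.Finite.exists_fin' A X
    exact ⟨ModuleCat.of A (Fin n → A), f, hf, inferInstanceAs (Module.Projective A (Fin n → A)),
      fun _ => inferInstanceAs (Module.Finite A (Fin n → A))⟩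
  · exact ⟨ModuleCat.of A (X →₀ A), Finsupp.linearCombination A id,
      Finsupp.linearCombination_id_surjective A X,
      inferInstanceAs (Module.Projective A (X →₀ A)), fun h => absurd h hX⟩

/-- The source of a chosen projective cover. -/
noncomputable def coverObj (X : ModuleCat.{u} A) : ModuleCat.{u} A :=
  (exists_projective_cover X).choose

/-- The chosen projective cover. -/
noncomputable def coverMap (X : ModuleCat.{u} A) : coverObj X →ₗ[A] X :=
  (exists_projective_cover X).choose_spec.choose

theorem coverMap_spec (X : ModuleCat.{u} A) :
    Function.Surjective (coverMap X) ∧ Module.Projective A (coverObj X) ∧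
      (Module.Finite A X → Module.Finite A (coverObj X)) :=
  (exists_projective_cover X).choose_spec.choose_spec

/-- The iterated syzygies of a module. -/
noncomputable def syzygy (X : ModuleCat.{u} A) : ℕ → ModuleCat.{u} A
  | 0 => X
  | n + 1 => ModuleCat.of A (LinearMap.ker (coverMap (syzygy X n)))

/-- The inclusion of a syzygy into the projective module covering the previous one. -/
noncomputable def syzygyInclusion (X : ModuleCat.{u} A) (n : ℕ) :
    syzygy X (n + 1) →ₗ[A] coverObj (syzygy X n) :=
  (LinearMap.ker (coverMap (syzygy X n))).subtype

theorem range_syzygyInclusion (X : ModuleCat.{u} A) (n : ℕ) :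
    LinearMap.range (syzygyInclusion X n) = LinearMap.ker (coverMap (syzygy X n)) :=
  Submodule.range_subtype _

theorem ker_syzygyInclusion (X : ModuleCat.{u} A) (n : ℕ) :
    LinearMap.ker (syzygyInclusion X n) = ⊥ :=
  Submodule.ker_subtype _

theorem exact_syzygy (X : ModuleCat.{u} A) (n : ℕ) :
    Function.Exact (syzygyInclusion X n ∘ₗ coverMap (syzygy X (n + 1))) (coverMap (syzygy X n)) := by
  rw [LinearMap.exact_iff, LinearMap.range_comp_of_range_eq_top _
    (LinearMap.range_eq_top.2 (coverMap_spec _).1), range_syzygyInclusion]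

end Resolution

/-! ### FP_1 through the augmentation ideal -/

section Augmentation

variable (R : Type u) [CommRing R]

/-- A monoid is of type `FP_1` if and only if the trivial module is finitely presented. -/
theorem isFP_one_iff_finitePresentation (M : Type u) [Monoid M] :
    IsFP R M 1 ↔
      Module.FinitePresentation (MonoidAlgebra R M) (Representation.trivial R M R).asModule := by
  constructor
  · rintro ⟨C, d, ε, hε, h0, -, hP, hF⟩
    have := hP 0
    have := hF 0 (by norm_num)
    have := hF 1 le_rfl
    have := Module.finitePresentation_of_projective (MonoidAlgebra R M) (C 0)
    refine Module.finitePresentation_of_surjective ε hε ?_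
    rw [h0.linearMap_ker_eq, LinearMap.range_eq_map]
    exact Submodule.FG.map _ Module.Finite.fg_top
  · intro h
    let X : ModuleCat.{u} (MonoidAlgebra R M) :=
      ModuleCat.of _ (Representation.trivial R M R).asModule
    have hX : Module.FinitePresentation (MonoidAlgebra R M) X := h
    refine ⟨fun n => coverObj (syzygy X n),
      fun n => syzygyInclusion X n ∘ₗ coverMap (syzygy X (n + 1)), coverMap X,
      (coverMap_spec X).1, ?_, fun n => ?_, fun n => (coverMap_spec _).2.1, fun n hn => ?_⟩
    · exact exact_syzygy X 0
    · rw [LinearMap.exact_iff, LinearMap.range_comp_of_range_eq_top _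
        (LinearMap.range_eq_top.2 (coverMap_spec _).1), range_syzygyInclusion,
        LinearMap.ker_comp_of_ker_eq_bot _ (ker_syzygyInclusion X n)]
    · have h0 : Module.Finite (MonoidAlgebra R M) (coverObj X) :=
        (coverMap_spec X).2.2 inferInstance
      interval_cases n
      · exact h0
      · refine (coverMap_spec _).2.2 ?_
        exact Module.Finite.iff_fg.2
          (Module.FinitePresentation.fg_ker (coverMap X) (coverMap_spec X).1)

/-- The left ideal of the monoid ring generated by the elements `x - 1` with `x ∈ X`. -/
noncomputable def augSpan {M : Type u} [Monoid M] (X : Set M) : Ideal (MonoidAlgebra R M) :=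
  Ideal.span ((fun x => MonoidAlgebra.of R M x - 1) '' X)

/-- The augmentation as a map of left modules. -/
noncomputable def augmentation (M : Type u) [Monoid M] :
    MonoidAlgebra R M →ₗ[MonoidAlgebra R M] (Representation.trivial R M R).asModule :=
  LinearMap.toSpanSingleton _ _ ((Representation.trivial R M R).asModuleEquiv.symm 1)

variable {R}

theorem augmentation_single {M : Type u} [Monoid M] (m : M) (r : R) :
    augmentation R M (MonoidAlgebra.single m r) =
      (Representation.trivial R M R).asModuleEquiv.symm r := by
  rw [augmentation, LinearMap.toSpanSingleton_apply, Representation.single_smul]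
  exact mul_one r

theorem ker_augmentation (M : Type u) [Monoid M] :
    LinearMap.ker (augmentation R M) = augSpan R Set.univ := by
  apply le_antisymm
  -- Modulo the left ideal, every x is congruent to its augmentation times 1.
  · have key : ∀ x : MonoidAlgebra R M, x - MonoidAlgebra.single 1
        ((Representation.trivial R M R).asModuleEquiv (augmentation R M x)) ∈
          augSpan R (Set.univ : Set M) := by
      intro x
      induction x using MonoidAlgebra.induction_linear with
      | zero => simp
      | add x y hx hy =>
        rw [map_add, map_add, MonoidAlgebra.single_add, add_sub_add_comm]
        exact add_mem hx hy
      | single m r =>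
        rw [augmentation_single, LinearEquiv.apply_symm_apply]
        have : MonoidAlgebra.single m r - MonoidAlgebra.single 1 r =
            MonoidAlgebra.single 1 r * (MonoidAlgebra.of R M m - 1) := by
          simp [mul_sub, MonoidAlgebra.single_mul_single]
        rw [this]
        exact Ideal.mul_mem_left _ _ (Ideal.subset_span ⟨m, trivial, rfl⟩)
    intro x hx
    have := key x
    rwa [LinearMap.mem_ker.1 hx, map_zero, MonoidAlgebra.single_zero, sub_zero] at this
  · refine Ideal.span_le.2 ?_
    rintro _ ⟨m, -, rfl⟩
    simp only [SetLike.mem_coe, LinearMap.mem_ker, map_sub, MonoidAlgebra.of_apply,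
      MonoidAlgebra.one_def, augmentation_single, sub_self]

theorem augmentation_surjective (M : Type u) [Monoid M] :
    Function.Surjective (augmentation R M) := fun x =>
  ⟨MonoidAlgebra.single 1 ((Representation.trivial R M R).asModuleEquiv x), by
    rw [augmentation_single, LinearEquiv.symm_apply_apply]⟩

variable (R)

/-- A monoid is of type `FP_1` if and only if its augmentation ideal is generated, as a left ideal,
by `x - 1` for finitely many `x`. -/
theorem isFP_one_iff (M : Type u) [Monoid M] :
    IsFP R M 1 ↔ ∃ X : Set M, X.Finite ∧ ∀ m, MonoidAlgebra.of R M m - 1 ∈ augSpan R X := by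
  rw [isFP_one_iff_finitePresentation]
  constructor
  · intro h
    have := Module.FinitePresentation.fg_ker (augmentation R M) (augmentation_surjective M)
    rw [ker_augmentation] at this
    -- A finitely generated span is already spanned by finitely many of the given generators m - 1.
    obtain ⟨s, hs, hs'⟩ := (Submodule.fg_span_iff_fg_span_finset_subset _).1 this
    obtain ⟨X, -, hX, hXs⟩ := s.finite_toSet.exists_subset_finite_image_eq hs
    refine ⟨X, hX, fun m => ?_⟩
    rw [augSpan, hXs, Ideal.span, ← hs']
    exact Ideal.subset_span ⟨m, trivial, rfl⟩
  · rintro ⟨X, hX, h⟩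
    refine Module.finitePresentation_of_surjective _ (augmentation_surjective M) ?_
    have : LinearMap.ker (augmentation R M) = augSpan R X := by
      rw [ker_augmentation]
      refine le_antisymm (Ideal.span_le.2 ?_) (Ideal.span_mono (Set.image_mono (Set.subset_univ _)))
      rintro _ ⟨m, -, rfl⟩
      exact h m
    rw [this]
    exact Submodule.fg_span (hX.image _)

variable {R}

/-- By ab - 1 = a(b - 1) + (a - 1), the elements m with m - 1 in the left ideal are closed under
products, so membership need only be checked on monoid generators. -/
theorem of_mul_sub_one_mem {M : Type u} [Monoid M] {X : Set M} {a b : M}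
    (ha : MonoidAlgebra.of R M a - 1 ∈ augSpan R X) (hb : MonoidAlgebra.of R M b - 1 ∈ augSpan R X) :
    MonoidAlgebra.of R M (a * b) - 1 ∈ augSpan R X := by
  have : MonoidAlgebra.of R M (a * b) - 1 = MonoidAlgebra.of R M a * (MonoidAlgebra.of R M b - 1) +
      (MonoidAlgebra.of R M a - 1) := by
    rw [map_mul]; noncomm_ring
  rw [this]
  exact add_mem (Ideal.mul_mem_left _ _ hb) ha

theorem augSpan_mono {M : Type u} [Monoid M] {X Y : Set M} (h : X ⊆ Y) :
    augSpan R X ≤ augSpan R Y :=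
  Ideal.span_mono (Set.image_mono h)

theorem of_sub_one_mem_augSpan_image {M N : Type u} [Monoid M] [Monoid N] (f : M →* N) {X : Set M}
    {m : M} (h : MonoidAlgebra.of R M m - 1 ∈ augSpan R X) :
    MonoidAlgebra.of R N (f m) - 1 ∈ augSpan R (f '' X) := by
  have := Ideal.mem_map_of_mem (MonoidAlgebra.mapDomainRingHom R f) h
  rw [augSpan, Ideal.map_span, Set.image_image] at this
  rw [augSpan, Set.image_image]
  have key : ∀ x, MonoidAlgebra.mapDomainRingHom R f (MonoidAlgebra.of R M x - 1) =
      MonoidAlgebra.of R N (f x) - 1 := fun x => by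
    rw [map_sub, map_one]; simp
  simpa only [key] using this

theorem IsFP.of_surjective {M N : Type u} [Monoid M] [Monoid N] (f : M →* N)
    (hf : Function.Surjective f) (h : IsFP R M 1) : IsFP R N 1 := by
  rw [isFP_one_iff] at h ⊢
  obtain ⟨X, hX, h⟩ := h
  refine ⟨f '' X, hX.image f, fun n => ?_⟩
  obtain ⟨m, rfl⟩ := hf n
  exact of_sub_one_mem_augSpan_image f (h m)

theorem exists_augSpan_of_fg (G : Type u) [Group G] [Group.FG G] :
    ∃ X : Set G, X.Finite ∧ ∀ g, MonoidAlgebra.of R G g - 1 ∈ augSpan R X := by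
  have : Monoid.FG G := Group.fg_iff_monoid_fg.1 inferInstance
  obtain ⟨S, hS, hfin⟩ := Monoid.fg_iff.1 this
  refine ⟨S, hfin, fun g => ?_⟩
  have hg : g ∈ Submonoid.closure S := hS ▸ Submonoid.mem_top g
  induction hg using Submonoid.closure_induction with
  | mem x hx => exact Ideal.subset_span ⟨x, hx, rfl⟩
  | one => rw [map_one, sub_self]; exact zero_mem _
  | mul x y _ _ hx hy => exact of_mul_sub_one_mem hx hy

theorem isFP_one_of_fg (G : Type u) [Group G] [Group.FG G] : IsFP R G 1 :=
  (isFP_one_iff R G).2 (exists_augSpan_of_fg G)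

/-- A monoid in which every element is a product of elements from the images of two monoids of type
`FP_1` is of type `FP_1`. -/
theorem IsFP.of_mul {M N P : Type u} [Monoid M] [Monoid N] [Monoid P] (f : M →* P) (k : N →* P)
    (hfk : ∀ p, ∃ m n, p = f m * k n) (hM : IsFP R M 1) (hN : IsFP R N 1) : IsFP R P 1 := by
  rw [isFP_one_iff] at hM hN ⊢
  obtain ⟨X, hX, hM⟩ := hM
  obtain ⟨Y, hY, hN⟩ := hN
  refine ⟨f '' X ∪ k '' Y, (hX.image f).union (hY.image k), fun p => ?_⟩
  obtain ⟨m, n, rfl⟩ := hfk p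
  exact of_mul_sub_one_mem
    (augSpan_mono Set.subset_union_left (of_sub_one_mem_augSpan_image f (hM m)))
    (augSpan_mono Set.subset_union_right (of_sub_one_mem_augSpan_image k (hN n)))

/-! ### Moves inside the monoid G_φ -/

/-- Two elements of `G_φ` whose difference lies in the left ideal generated by the elements `s - 1`,
where `s ∈ T` and `φ(s) ≥ 0`. -/
def AugRel (R : Type u) [CommRing R] {G : Type u} [Group G] (φ : G →* Multiplicative ℤ) (T : Set G)
    (x y : G) : Prop :=
  ∃ (hx : x ∈ nonnegMonoid φ) (hy : y ∈ nonnegMonoid φ),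
    MonoidAlgebra.of R (nonnegMonoid φ) ⟨x, hx⟩ - MonoidAlgebra.of R (nonnegMonoid φ) ⟨y, hy⟩ ∈
      augSpan R (Subtype.val ⁻¹' T : Set (nonnegMonoid φ))

section AugRel

variable {G : Type u} [Group G] {φ : G →* Multiplicative ℤ} {T : Set G}

theorem mem_nonnegMonoid {g : G} : g ∈ nonnegMonoid φ ↔ 0 ≤ (φ g).toAdd := Iff.rfl

theorem AugRel.refl {x : G} (hx : x ∈ nonnegMonoid φ) : AugRel R φ T x x :=
  ⟨hx, hx, by rw [sub_self]; exact zero_mem _⟩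

theorem AugRel.symm {x y : G} (h : AugRel R φ T x y) : AugRel R φ T y x := by
  obtain ⟨hx, hy, h⟩ := h
  exact ⟨hy, hx, by rw [← neg_sub]; exact neg_mem h⟩

theorem AugRel.trans {x y z : G} (h : AugRel R φ T x y) (h' : AugRel R φ T y z) :
    AugRel R φ T x z := by
  obtain ⟨hx, hy, h⟩ := h
  obtain ⟨_, hz, h'⟩ := h'
  exact ⟨hx, hz, by rw [← sub_add_sub_cancel]; exact add_mem h h'⟩

theorem AugRel.mul_of_nonneg {x s : G} (hs : s ∈ T) (hx : x ∈ nonnegMonoid φ)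
    (h : s ∈ nonnegMonoid φ) : AugRel R φ T x (x * s) := by
  refine AugRel.symm ⟨mul_mem hx h, hx, ?_⟩
  have : MonoidAlgebra.of R (nonnegMonoid φ) ⟨x * s, mul_mem hx h⟩ -
      MonoidAlgebra.of R (nonnegMonoid φ) ⟨x, hx⟩ = MonoidAlgebra.of R (nonnegMonoid φ) ⟨x, hx⟩ *
        (MonoidAlgebra.of R (nonnegMonoid φ) ⟨s, h⟩ - 1) := by
    rw [mul_sub, ← map_mul, mul_one]; rfl
  rw [this]
  exact Ideal.mul_mem_left _ _ (Ideal.subset_span ⟨⟨s, h⟩, hs, rfl⟩)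

/-- A move that descends from x to xs is the reverse of the ascending move from xs by s⁻¹, so
symmetry of T lets every generator be used as long as both endpoints stay in G_φ. -/
theorem AugRel.mul {x s : G} (hT : ∀ t ∈ T, t⁻¹ ∈ T) (hs : s ∈ T) (hx : x ∈ nonnegMonoid φ)
    (hxs : x * s ∈ nonnegMonoid φ) : AugRel R φ T x (x * s) := by
  rcases le_total 0 (φ s).toAdd with h | h
  · exact AugRel.mul_of_nonneg hs hx h
  · have h' : s⁻¹ ∈ nonnegMonoid φ := by
      rw [mem_nonnegMonoid, map_inv, toAdd_inv]; omega
    have := AugRel.mul_of_nonneg (R := R) (hT s hs) hxs h'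
    rw [mul_inv_cancel_right] at this
    exact this.symm

theorem AugRel.mul_pow {x s : G} (hs : s ∈ T) (hx : x ∈ nonnegMonoid φ)
    (h : s ∈ nonnegMonoid φ) (n : ℕ) : AugRel R φ T x (x * s ^ n) := by
  induction n with
  | zero => rw [pow_zero, mul_one]; exact AugRel.refl hx
  | succ n ih =>
    rw [pow_succ, ← mul_assoc]
    exact ih.trans (AugRel.mul_of_nonneg hs (mul_mem hx (pow_mem h n)) h)

/-- High above the boundary of `G_φ`, multiplication by a fixed element does not change the
class. -/
theorem exists_bound_augRel (hT : ∀ t ∈ T, t⁻¹ ∈ T) (hgen : Submonoid.closure T = ⊤) (g : G) :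
    ∃ N : ℤ, ∀ x, N ≤ (φ x).toAdd → AugRel R φ T x (x * g) := by
  have hg : g ∈ Submonoid.closure T := hgen ▸ Submonoid.mem_top g
  induction hg using Submonoid.closure_induction with
  | mem s hs =>
    -- At height at least |φ(s)|, both x and xs lie in G_φ.
    refine ⟨|(φ s).toAdd|, fun x hx => AugRel.mul hT hs ?_ ?_⟩
    · exact (abs_nonneg _).trans hx
    · rw [mem_nonnegMonoid, map_mul, toAdd_mul]
      have := neg_abs_le (φ s).toAdd
      omega
  | one => exact ⟨0, fun x hx => by rw [mul_one]; exact AugRel.refl hx⟩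
  | mul a b _ _ ha hb =>
    obtain ⟨N, hN⟩ := ha
    obtain ⟨N', hN'⟩ := hb
    -- The second move starts at xa, whose height must be at least N'.
    refine ⟨max N (N' - (φ a).toAdd), fun x hx => ?_⟩
    rw [← mul_assoc]
    refine (hN x (le_trans (le_max_left _ _) hx)).trans (hN' _ ?_)
    rw [map_mul, toAdd_mul]
    have := le_trans (le_max_right _ _) hx
    omega

/-- Powers of b lift x above the bound for g, after which multiplication by g is free, even when
φ(g) is negative. -/
theorem exists_augRel_mul_pow (hT : ∀ t ∈ T, t⁻¹ ∈ T) (hgen : Submonoid.closure T = ⊤) {b : G}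
    (hbT : b ∈ T) (hb : 0 < (φ b).toAdd) {x : G} (hx : x ∈ nonnegMonoid φ) (g : G) :
    ∃ n : ℕ, AugRel R φ T x (x * b ^ n * g) := by
  obtain ⟨N, hN⟩ := exists_bound_augRel (R := R) (φ := φ) hT hgen g
  refine ⟨N.toNat, (AugRel.mul_pow hbT hx hb.le N.toNat).trans (hN _ ?_)⟩
  rw [map_mul, toAdd_mul, map_pow, toAdd_pow, nsmul_eq_mul]
  have h1 : 0 ≤ (φ x).toAdd := hx
  have h2 : N ≤ (N.toNat : ℤ) := Int.self_le_toNat N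
  nlinarith [Int.natCast_nonneg N.toNat]

end AugRel

/-- If `G` is a finitely generated product of two commuting subgroups on both of which `φ` is
non-trivial, then `G_φ` is of type `FP_1`. -/
theorem isFP_one_nonnegMonoid_of_commute {G H L : Type u} [Group G] [Group H] [Group L]
    [Group.FG G] (i : H →* G) (j : L →* G) (hcomm : ∀ h l, Commute (i h) (j l))
    (hij : ∀ g, ∃ h l, g = i h * j l) (φ : G →* Multiplicative ℤ)
    (hi : φ.comp i ≠ 1) (hj : φ.comp j ≠ 1) : IsFP R (nonnegMonoid φ) 1 := by
  have pos : ∀ {K : Type u} [Group K] (ψ : K →* Multiplicative ℤ), ψ ≠ 1 →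
      ∃ a, 0 < (ψ a).toAdd := by
    intro K _ ψ hψ
    obtain ⟨a, ha⟩ := DFunLike.ne_iff.1 hψ
    have ha' : (ψ a).toAdd ≠ 0 := ha
    rcases lt_or_gt_of_ne ha' with h | h
    · exact ⟨a⁻¹, by rw [map_inv, toAdd_inv]; omega⟩
    · exact ⟨a, h⟩
  obtain ⟨a, ha⟩ := pos _ hi
  obtain ⟨b, hb⟩ := pos _ hj
  have : Monoid.FG G := Group.fg_iff_monoid_fg.1 inferInstance
  obtain ⟨S, hS, hfin⟩ := Monoid.fg_iff.1 this
  -- The two elements of positive height are added to the generators so that they are available as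
  -- single moves.
  let S' : Set G := S ∪ {i a, j b}
  have hfin' : S'.Finite := hfin.union (Set.toFinite _)
  let T : Set G := S' ∪ S'⁻¹
  have hT : ∀ t ∈ T, t⁻¹ ∈ T := by
    rintro t (h | h)
    · exact Or.inr (by simpa using h)
    · exact Or.inl h
  have hgen : Submonoid.closure T = ⊤ :=
    top_le_iff.1 (hS ▸ Submonoid.closure_mono fun s hs => Or.inl (Or.inl hs))
  have haT : i a ∈ T := Or.inl (Or.inr (Or.inl rfl))
  have hbT : j b ∈ T := Or.inl (Or.inr (Or.inr rfl))
  refine (isFP_one_iff R _).2 ⟨Subtype.val ⁻¹' T,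
    (hfin'.union hfin'.inv).preimage Subtype.val_injective.injOn, ?_⟩
  rintro ⟨g, hg⟩
  suffices AugRel R φ T g 1 by
    obtain ⟨_, _, h⟩ := this
    exact h
  obtain ⟨h, l, rfl⟩ := hij g
  -- Lifting by b in L and then multiplying by h⁻¹ removes the H-component, since h commutes with L.
  -- Lifting by a in H then removes the L-component in the same way. What is left is a^m, which is
  -- related to 1 by ascending moves.
  obtain ⟨n, hn⟩ := exists_augRel_mul_pow (R := R) hT hgen hbT hb hg (i h)⁻¹
  have e : i h * j l * j b ^ n * (i h)⁻¹ = j (l * b ^ n) := by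
    rw [map_mul, map_pow, mul_assoc (i h), ← map_pow, ← map_mul, (hcomm _ _).eq,
      mul_inv_cancel_right]
  rw [e] at hn
  obtain ⟨_, hl, _⟩ := id hn
  obtain ⟨m, hm⟩ := exists_augRel_mul_pow (R := R) hT hgen haT ha hl (j (l * b ^ n))⁻¹
  rw [← map_pow, ← (hcomm _ _).eq, mul_inv_cancel_right, map_pow] at hm
  refine hn.trans (hm.trans (AugRel.symm ?_))
  simpa using AugRel.mul_pow (R := R) haT (one_mem _) ha.le m

end Augmentation

/-! ### Torsion and duality with the fraction field -/

section FractionField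

variable {S : Type u} [CommRing S] [IsDomain S]

theorem fractionRank_eq_zero_iff (M : Type u) [AddCommGroup M] [Module S M] :
    fractionRank S M = 0 ↔ ∀ m : M, ∃ s : S, s ≠ 0 ∧ s • m = 0 := by
  rw [fractionRank, rank_zero_iff,
    IsLocalizedModule.subsingleton_iff (nonZeroDivisors S)
      (TensorProduct.mk S (FractionRing S) M 1)]
  simp only [mem_nonZeroDivisors_iff_ne_zero]

/-- The fraction field of a domain is an injective module. -/
theorem baer_fractionRing : Module.Baer S (FractionRing S) := by
  intro I g
  by_cases hI : I = ⊥
  · subst hI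
    refine ⟨0, fun x hx => ?_⟩
    have : (⟨x, hx⟩ : (⊥ : Ideal S)) = 0 := Subsingleton.elim _ _
    rw [this, map_zero, LinearMap.zero_apply]
  · obtain ⟨a, ha, ha0⟩ := Submodule.exists_mem_ne_zero_of_ne_bot hI
    have hne : algebraMap S (FractionRing S) a ≠ 0 := by simpa using ha0
    -- The extension is x ↦ x g(a)/a for one fixed non-zero a in I; it agrees with g on I because a
    -- g(x) = g(ax) = x g(a).
    refine ⟨LinearMap.toSpanSingleton S _ ((algebraMap S (FractionRing S) a)⁻¹ * g ⟨a, ha⟩),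
      fun x hx => ?_⟩
    have h : a • g ⟨x, hx⟩ = x • g ⟨a, ha⟩ := by
      rw [← map_smul, ← map_smul]
      congr 1
      exact Subtype.ext (mul_comm _ _)
    rw [Algebra.smul_def, Algebra.smul_def] at h
    rw [LinearMap.toSpanSingleton_apply, Algebra.smul_def]
    field_simp
    linear_combination -h

/-- Such an m spans a free submodule of rank one, and injectivity of the fraction field extends s •
m ↦ s to all of M. -/
theorem exists_linearMap_ne_zero {M : Type u} [AddCommGroup M] [Module S M] (m : M)
    (hm : ∀ s : S, s • m = 0 → s = 0) : ∃ f : M →ₗ[S] FractionRing S, f m ≠ 0 := by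
  obtain ⟨f, hf⟩ := Module.Baer.extension_property baer_fractionRing
    (LinearMap.toSpanSingleton S M m)
    ((injective_iff_map_eq_zero _).2 fun s hs => hm s (by simpa using hs))
    (LinearMap.toSpanSingleton S (FractionRing S) 1)
  refine ⟨f, ?_⟩
  have := LinearMap.congr_fun hf 1
  simp only [LinearMap.comp_apply, LinearMap.toSpanSingleton_apply, one_smul] at this
  rw [this]
  exact one_ne_zero

/-- The homology of `C₂ → C₁ → C₀` is torsion if and only if the cohomology of the dual complex
with coefficients in the fraction field vanishes. -/
theorem homology_torsion_iff {C₂ C₁ C₀ : Type u} [AddCommGroup C₂] [AddCommGroup C₁]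
    [AddCommGroup C₀] [Module S C₂] [Module S C₁] [Module S C₀] (d₂ : C₂ →ₗ[S] C₁)
    (d₁ : C₁ →ₗ[S] C₀) :
    (∀ z, d₁ z = 0 → ∃ s : S, s ≠ 0 ∧ s • z ∈ LinearMap.range d₂) ↔
      ∀ f : C₁ →ₗ[S] FractionRing S, f ∘ₗ d₂ = 0 → ∃ c : C₀ →ₗ[S] FractionRing S, f = c ∘ₗ d₁ := by
  constructor
  · intro h f hf
    -- The target is torsion-free, so f kills every cycle. It then factors through the image of d₁,
    -- and injectivity extends it to C₀.
    have hker : LinearMap.ker d₁ ≤ LinearMap.ker f := by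
      intro z hz
      obtain ⟨s, hs, w, hw⟩ := h z hz
      have : f (s • z) = 0 := by rw [← hw]; exact LinearMap.congr_fun hf w
      rw [map_smul] at this
      exact (smul_eq_zero.1 this).resolve_left hs
    obtain ⟨c, hc⟩ := Module.Baer.extension_property baer_fractionRing
      ((LinearMap.ker d₁).liftQ d₁ le_rfl)
      (LinearMap.ker_eq_bot.1 (Submodule.ker_liftQ_eq_bot _ _ _ le_rfl))
      ((LinearMap.ker d₁).liftQ f hker)
    refine ⟨c, LinearMap.ext fun x => ?_⟩
    exact (LinearMap.congr_fun hc (Submodule.Quotient.mk x)).symm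
  · intro h z hz
    by_contra! hcon
    -- A non-torsion class is detected by a functional killing boundaries; that functional cannot
    -- factor through d₁, because d₁ z = 0.
    obtain ⟨f, hf⟩ := exists_linearMap_ne_zero ((LinearMap.range d₂).mkQ z) (S := S)
      fun s hs => by
        by_contra hs0
        rw [← map_smul, Submodule.mkQ_apply, Submodule.Quotient.mk_eq_zero] at hs
        exact hcon s hs0 hs
    obtain ⟨c, hc⟩ := h (f ∘ₗ (LinearMap.range d₂).mkQ) (by
      rw [LinearMap.comp_assoc, LinearMap.range_mkQ_comp, LinearMap.comp_zero])
    have := LinearMap.congr_fun hc z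
    rw [LinearMap.comp_apply, LinearMap.comp_apply, hz, map_zero] at this
    exact hf this

end FractionField

/-! ### Twisted Alexander modules in degrees 0 and 1 -/

section Alexander

variable {R : Type u} [CommRing R] {G Q : Type u} [Group G] [Group Q]

/-- The power `t^n` in the fraction field of `R[t^{±1}]`. -/
noncomputable def tPow (R : Type u) [CommRing R] (n : Multiplicative ℤ) :
    FractionRing R[T;T⁻¹] :=
  algebraMap R[T;T⁻¹] _ (LaurentPolynomial.T n.toAdd)

theorem T_ne_one [IsDomain R] {n : ℤ} (hn : n ≠ 0) : (LaurentPolynomial.T n : R[T;T⁻¹]) ≠ 1 := by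
  intro h
  have := congrArg (fun p => AddMonoidAlgebra.coeff p n) h
  simp only [AddMonoidAlgebra.one_def, LaurentPolynomial.T_apply, AddMonoidAlgebra.coeff_single,
    Finsupp.single_apply, if_pos, if_neg hn.symm] at this
  exact one_ne_zero this

theorem tPow_ne_one [IsDomain R] {n : Multiplicative ℤ} (hn : n ≠ 1) : tPow R n ≠ 1 := by
  intro h
  rw [tPow, ← map_one (algebraMap R[T;T⁻¹] (FractionRing R[T;T⁻¹]))] at h
  exact T_ne_one (R := R) (n := n.toAdd) hn (IsFractionRing.injective _ _ h)

/-- A character that is non-trivial on a subgroup is non-trivial on its intersection with the kernel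
of a homomorphism to a finite group. -/
theorem exists_map_ne_one {K : Type u} [Group K] [Finite Q] (φ : G →* Multiplicative ℤ)
    (α : G →* Q) (i : K →* G) (hi : φ.comp i ≠ 1) : ∃ k, φ (i k) ≠ 1 ∧ α (i k) = 1 := by
  obtain ⟨k, hk⟩ := DFunLike.ne_iff.1 hi
  -- The order of Q kills α, while ℤ is torsion-free, so φ stays non-trivial.
  refine ⟨k ^ Nat.card Q, ?_, ?_⟩
  · rw [map_pow, map_pow]
    intro h
    have h' : (Nat.card Q : ℤ) * (φ (i k)).toAdd = 0 := by
      simpa using congrArg Multiplicative.toAdd h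
    rcases mul_eq_zero.1 h' with h' | h'
    · exact Nat.card_pos.ne' (Int.natCast_eq_zero.1 h')
    · exact hk h'
  · rw [map_pow, map_pow, pow_card_eq_one']

theorem tPow_mul (m n : Multiplicative ℤ) : tPow R (m * n) = tPow R m * tPow R n := by
  rw [tPow, toAdd_mul, LaurentPolynomial.T_add, map_mul, tPow, tPow]

/-- One-cocycles of `G` with values in the functions on `Q`, twisted by `φ` and `α`. -/
def IsTwistedCocycle (R : Type u) [CommRing R] (φ : G →* Multiplicative ℤ) (α : G →* Q)
    (f : G → Q → FractionRing R[T;T⁻¹]) : Prop :=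
  ∀ g h q, f (g * h) q = f g q + tPow R (φ g) * f h (q * α g)

/-- One-coboundaries of `G` with values in the functions on `Q`, twisted by `φ` and `α`. -/
def IsTwistedCoboundary (R : Type u) [CommRing R] (φ : G →* Multiplicative ℤ) (α : G →* Q)
    (f : G → Q → FractionRing R[T;T⁻¹]) : Prop :=
  ∃ c : Q → FractionRing R[T;T⁻¹], ∀ g q, f g q = tPow R (φ g) * c (q * α g) - c q

section Homology

open CategoryTheory

variable {S : Type u} [CommRing S]

theorem forall_H1_torsion_iff (A : Rep.{u} S G) :
    (∀ m : groupHomology A 1, ∃ s : S, s ≠ 0 ∧ s • m = 0) ↔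
      ∀ z : G →₀ A, (groupHomology.d₁₀ A).hom z = 0 → ∃ s : S, s ≠ 0 ∧
        s • z ∈ LinearMap.range (groupHomology.d₂₁ A).hom := by
  constructor
  · intro h z hz
    let z' : groupHomology.cycles₁ A := ⟨z, hz⟩
    obtain ⟨s, hs, hsz⟩ := h ((groupHomology.H1π A).hom z')
    refine ⟨s, hs, ?_⟩
    exact (groupHomology.H1π_eq_zero_iff (s • z')).1
      (((groupHomology.H1π A).hom.map_smul s z').trans hsz)
  · intro h m
    induction m using groupHomology.H1_induction_on with
    | h z =>
      obtain ⟨s, hs, hsz⟩ := h z.1 z.2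
      refine ⟨s, hs, ?_⟩
      exact ((groupHomology.H1π A).hom.map_smul s z).symm.trans
        ((groupHomology.H1π_eq_zero_iff (s • z)).2 hsz)

theorem H0_torsion_of_forall (A : Rep.{u} S G) (s : S)
    (h : ∀ a : A, s • a ∈ LinearMap.range (groupHomology.d₁₀ A).hom)
    (m : groupHomology A 0) : s • m = 0 := by
  induction m using groupHomology.H0_induction_on with
  | h a =>
    obtain ⟨z, hz⟩ := h a
    refine ((groupHomology.H0π A).hom.map_smul s a).symm.trans ?_
    rw [← hz]
    have : groupHomology.d₁₀ A ≫ groupHomology.H0π A = 0 := by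
      rw [← groupHomology.coinvariantsMk_comp_H0Iso_inv,
        groupHomology.d₁₀_comp_coinvariantsMk_assoc, Limits.zero_comp]
    exact LinearMap.congr_fun (congrArg ModuleCat.Hom.hom this) z

end Homology

/-- The linear functional on the group ring given by a function on the group. -/
noncomputable def functional {Q : Type u} (c : Q → FractionRing R[T;T⁻¹]) :
    MonoidAlgebra R[T;T⁻¹] Q →ₗ[R[T;T⁻¹]] FractionRing R[T;T⁻¹] :=
  Finsupp.linearCombination R[T;T⁻¹] c ∘ₗ (MonoidAlgebra.coeffLinearEquiv R[T;T⁻¹]).toLinearMap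

theorem functional_single {Q : Type u} (c : Q → FractionRing R[T;T⁻¹]) (q : Q) (s : R[T;T⁻¹]) :
    functional c (MonoidAlgebra.single q s) = s • c q := by
  simp [functional]

theorem linearMap_ext {Q : Type u} {f g : MonoidAlgebra R[T;T⁻¹] Q →ₗ[R[T;T⁻¹]] FractionRing R[T;T⁻¹]}
    (h : ∀ q, f (MonoidAlgebra.single q 1) = g (MonoidAlgebra.single q 1)) : f = g :=
  MonoidAlgebra.lhom_ext' fun q => LinearMap.ext_ring (h q)

/-- The bar differentials act through g⁻¹ on the left, which recovers the original right action of
g; this is why t^{φ(g)} and q α(g) appear in the cocycle identity. -/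
theorem twistedRep_inv_single (φ : G →* Multiplicative ℤ) (α : G →* Q) (g : G) (q : Q)
    (s : R[T;T⁻¹]) : twistedRep R φ α g⁻¹ (MonoidAlgebra.single q s) =
      (LaurentPolynomial.T (φ g).toAdd : R[T;T⁻¹]) • MonoidAlgebra.single (q * α g) s := by
  simp [twistedRep, MonoidAlgebra.single_mul_single, mul_comm]

theorem d₁₀_twistedRep_single (φ : G →* Multiplicative ℤ) (α : G →* Q) (g : G) (q : Q) :
    (groupHomology.d₁₀ (Rep.of (twistedRep R φ α))).hom
        (Finsupp.single g (MonoidAlgebra.single q 1)) =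
      (LaurentPolynomial.T (φ g).toAdd : R[T;T⁻¹]) • MonoidAlgebra.single (q * α g) 1 -
        MonoidAlgebra.single q 1 := by
  rw [← twistedRep_inv_single]
  exact groupHomology.d₁₀_single (Rep.of (twistedRep R φ α)) g _

theorem d₂₁_twistedRep_single (φ : G →* Multiplicative ℤ) (α : G →* Q) (g h : G) (q : Q) :
    (groupHomology.d₂₁ (Rep.of (twistedRep R φ α))).hom
        (Finsupp.single (g, h) (MonoidAlgebra.single q 1)) =
      (LaurentPolynomial.T (φ g).toAdd : R[T;T⁻¹]) •
          Finsupp.single h (MonoidAlgebra.single (q * α g) 1) -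
        Finsupp.single (g * h) (MonoidAlgebra.single q 1) +
        Finsupp.single g (MonoidAlgebra.single q 1) := by
  rw [Finsupp.smul_single, ← twistedRep_inv_single]
  exact groupHomology.d₂₁_single (A := Rep.of (twistedRep R φ α)) (g, h) _

theorem T_smul_eq (n : Multiplicative ℤ) (x : FractionRing R[T;T⁻¹]) :
    (LaurentPolynomial.T n.toAdd : R[T;T⁻¹]) • x = tPow R n * x :=
  Algebra.smul_def _ _

theorem map_boundary {G : Type u} (F : (G →₀ MonoidAlgebra R[T;T⁻¹] Q) →ₗ[R[T;T⁻¹]] FractionRing R[T;T⁻¹])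
    (n : Multiplicative ℤ) (x y z : G →₀ MonoidAlgebra R[T;T⁻¹] Q) :
    F ((LaurentPolynomial.T n.toAdd : R[T;T⁻¹]) • x - y + z) = tPow R n * F x - F y + F z :=
  (F.map_add _ _).trans (congrArg (· + F z) ((map_sub F.toAddMonoidHom _ _).trans
    (congrArg (· - F y) ((F.map_smul _ x).trans (T_smul_eq n (F x))))))

theorem mul_single_one_eq_smul (x : MonoidAlgebra R[T;T⁻¹] Q) (t : R[T;T⁻¹]) :
    x * MonoidAlgebra.single 1 t = t • x := by
  ext q : 2
  simp [mul_comm]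

/-- The first twisted Alexander polynomial does not vanish if and only if every twisted cocycle is
a coboundary. -/
theorem nonvanishingAlexander_one_iff [IsDomain R] (φ : G →* Multiplicative ℤ) (α : G →* Q) :
    NonvanishingAlexander R φ α 1 ↔
      ∀ f, IsTwistedCocycle R φ α f → IsTwistedCoboundary R φ α f := by
  rw [NonvanishingAlexander, fractionRank_eq_zero_iff]
  refine (forall_H1_torsion_iff _).trans ((homology_torsion_iff _ _).trans ?_)
  constructor
  · intro h f hf
    -- Functionals on 1-chains are functions on G × Q; vanishing on boundaries is the cocycle
    -- identity, and factoring through `d₁₀` is being a coboundary.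
    let F : (G →₀ MonoidAlgebra R[T;T⁻¹] Q) →ₗ[R[T;T⁻¹]] FractionRing R[T;T⁻¹] :=
      Finsupp.lsum R[T;T⁻¹] fun g => functional (f g)
    have hF : ∀ g q, F (Finsupp.single g (MonoidAlgebra.single q 1)) = f g q := fun g q => by
      simp only [F, Finsupp.lsum_single, functional_single, one_smul]
    obtain ⟨c, hc⟩ := h F (by
      refine Finsupp.lhom_ext' fun g => linearMap_ext fun q => ?_
      refine (congrArg F (d₂₁_twistedRep_single φ α g.1 g.2 q)).trans ?_
      refine (map_boundary F _ _ _ _).trans ?_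
      rw [hF, hF, hF, hf]
      change _ = (0 : FractionRing R[T;T⁻¹])
      ring)
    refine ⟨fun q => c (MonoidAlgebra.single q 1), fun g q => ?_⟩
    rw [← hF, ← T_smul_eq]
    refine (LinearMap.congr_fun hc (Finsupp.single g (MonoidAlgebra.single q 1))).trans ?_
    refine (congrArg c (d₁₀_twistedRep_single φ α g q)).trans ?_
    exact (c.map_sub _ _).trans (congrArg (· - _) (c.map_smul _ _))
  · intro h F hF
    obtain ⟨c, hc⟩ := h (fun g q => F (Finsupp.single g (MonoidAlgebra.single q 1))) (by
      intro g k q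
      have := LinearMap.congr_fun hF (Finsupp.single (g, k) (MonoidAlgebra.single q 1))
      have := (congrArg F (d₂₁_twistedRep_single φ α g k q)).symm.trans this
      have := (map_boundary F _ _ _ _).symm.trans this
      rw [LinearMap.zero_apply] at this
      linear_combination -this)
    refine ⟨functional c, ?_⟩
    refine Finsupp.lhom_ext' fun g => linearMap_ext fun q => ?_
    refine (hc g q).trans ?_
    refine Eq.trans ?_ (congrArg (functional c) (d₁₀_twistedRep_single φ α g q)).symm
    rw [map_sub, map_smul, functional_single, functional_single, one_smul, one_smul, T_smul_eq]

/-- The zeroth twisted Alexander polynomials of a non-trivial character never vanish. -/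
theorem nonvanishingAlexander_zero [IsDomain R] [Finite Q] (φ : G →* Multiplicative ℤ) (α : G →* Q)
    (hφ : φ ≠ 1) : NonvanishingAlexander R φ α 0 := by
  rw [NonvanishingAlexander, fractionRank_eq_zero_iff]
  obtain ⟨g, hg, hg'⟩ := exists_map_ne_one (K := G) φ α (MonoidHom.id G) hφ
  -- As α(g) = 1, the boundary of g ⊗ a is (t^{φ(g)} - 1)a, so this one scalar annihilates H_0.
  refine fun m => ⟨LaurentPolynomial.T (φ g).toAdd - 1, sub_ne_zero.2 (T_ne_one hg),
    H0_torsion_of_forall _ _ (fun a => ⟨Finsupp.single g a, ?_⟩) m⟩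
  refine (groupHomology.d₁₀_single (Rep.of (twistedRep R φ α)) g a).trans ?_
  rw [sub_smul, one_smul]
  congr 1
  change a * MonoidAlgebra.single (α g⁻¹⁻¹) (LaurentPolynomial.T (φ g⁻¹⁻¹).toAdd) = _
  have hg'' : α g = 1 := hg'
  rw [inv_inv, hg'']
  exact mul_single_one_eq_smul _ _

end Alexander

/-! ### Vanishing of twisted cocycles -/

section Cocycles

variable {R : Type u} [CommRing R] {G Q : Type u} [Group G] [Group Q]
  {φ : G →* Multiplicative ℤ} {α : G →* Q} {f : G → Q → FractionRing R[T;T⁻¹]}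

/-- Subtracting a coboundary from a cocycle gives a cocycle. -/
theorem IsTwistedCocycle.sub_coboundary (hf : IsTwistedCocycle R φ α f)
    (c : Q → FractionRing R[T;T⁻¹]) :
    IsTwistedCocycle R φ α fun g q => f g q - (tPow R (φ g) * c (q * α g) - c q) := by
  intro g h q
  simp only [hf g h q, map_mul, tPow_mul, mul_assoc]
  ring

/-- A cocycle is zero if it vanishes on the kernel of `α` in a normal subgroup on which `φ` is
non-trivial. -/
theorem IsTwistedCocycle.eq_zero [IsDomain R] [Finite Q] (hf : IsTwistedCocycle R φ α f)
    {K : Type u} [Group K] (i : K →* G) (hi : φ.comp i ≠ 1)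
    (hnormal : ∀ k g, ∃ k', i k * g = g * i k')
    (h0 : ∀ k q, α (i k) = 1 → f (i k) q = 0) (g : G) (q : Q) : f g q = 0 := by
  obtain ⟨k, hk, hαk⟩ := exists_map_ne_one φ α i hi
  obtain ⟨k', hk'⟩ := hnormal k g
  have hαk' : α (i k') = 1 := by
    have := congrArg α hk'
    rw [map_mul, map_mul, hαk, one_mul] at this
    exact left_eq_mul.1 this
  -- Expanding f on kg = gk' in both ways gives t^{φ(k)} f(g) = f(g), because f vanishes on k and
  -- k'.
  have h1 := hf (i k) g q
  have h2 := hf g (i k') q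
  rw [h0 k q hαk, hαk, mul_one] at h1
  rw [h0 k' _ hαk', ← hk', h1] at h2
  have h3 : (tPow R (φ (i k)) - 1) * f g q = 0 := by linear_combination h2
  exact (mul_eq_zero.1 h3).resolve_left (sub_ne_zero.2 (tPow_ne_one hk))

end Cocycles

/-! ### Commuting factors and pulled-back characters -/

section Product

variable {R : Type u} [CommRing R] {G H L : Type u} [Group G] [Group H] [Group L]
  {i : H →* G} {j : L →* G} {p : G →* H}

theorem exists_mul_eq_mul_of_commute (hcomm : ∀ h l, Commute (i h) (j l))
    (hij : ∀ g, ∃ h l, g = i h * j l) (k : H) (g : G) : ∃ k', i k * g = g * i k' := by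
  obtain ⟨h, l, rfl⟩ := hij g
  refine ⟨h⁻¹ * k * h, ?_⟩
  rw [mul_assoc (i h), ← (hcomm _ l).eq]
  simp [mul_assoc]

/-- If `φ` is non-trivial on two commuting subgroups with product `G`, then its first twisted
Alexander polynomials do not vanish. -/
theorem nonvanishingTwistedAlexander_one_of_commute [IsDomain R]
    (hcomm : ∀ h l, Commute (i h) (j l)) (hij : ∀ g, ∃ h l, g = i h * j l)
    (φ : G →* Multiplicative ℤ) (hi : φ.comp i ≠ 1) (hj : φ.comp j ≠ 1) :
    NonvanishingTwistedAlexander R φ 1 := by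
  intro Q _ _ α _
  rw [nonvanishingAlexander_one_iff]
  intro f hf
  obtain ⟨l, hl, hαl⟩ := exists_map_ne_one φ α j hj
  have ht : tPow R (φ (j l)) - 1 ≠ 0 := sub_ne_zero.2 (tPow_ne_one hl)
  -- As α(l) = 1, the coboundary of c takes the value (t^{φ(l)} - 1)c(q) at l, so this c makes the
  -- corrected cocycle vanish there.
  let c : Q → FractionRing R[T;T⁻¹] := fun q => (tPow R (φ (j l)) - 1)⁻¹ * f (j l) q
  have hf' := hf.sub_coboundary c
  set f' : G → Q → FractionRing R[T;T⁻¹] :=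
    fun g q => f g q - (tPow R (φ g) * c (q * α g) - c q) with hfdef
  have hl0 : ∀ q, f' (j l) q = 0 := by
    intro q
    simp only [hfdef, hαl, mul_one, c]
    field_simp
    ring
  have hi0 : ∀ k q, f' (i k) q = 0 := by
    intro k q
    -- Expanding on kl = lk gives f'(k) = t^{φ(l)} f'(k).
    have h1 := hf' (i k) (j l) q
    have h2 := hf' (j l) (i k) q
    rw [hl0, mul_zero, add_zero] at h1
    rw [hl0, hαl, mul_one, ← (hcomm k l).eq, h1] at h2
    have h3 : (tPow R (φ (j l)) - 1) * f' (i k) q = 0 := by linear_combination -h2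
    exact (mul_eq_zero.1 h3).resolve_left ht
  refine ⟨c, fun g q => sub_eq_zero.1 ?_⟩
  exact hf'.eq_zero i hi (exists_mul_eq_mul_of_commute hcomm hij) (fun k q _ => hi0 k q) g q

/-- The first twisted Alexander polynomials of a character and of its pullback to a product vanish
simultaneously. -/
theorem nonvanishingTwistedAlexander_one_comp_iff [IsDomain R]
    (hcomm : ∀ h l, Commute (i h) (j l)) (hij : ∀ g, ∃ h l, g = i h * j l)
    (hpi : ∀ h, p (i h) = h) (ψ : H →* Multiplicative ℤ) (hψ : ψ ≠ 1) :
    NonvanishingTwistedAlexander R (ψ.comp p) 1 ↔ NonvanishingTwistedAlexander R ψ 1 := by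
  constructor
  · intro h Q _ _ α hα
    have h' := h Q (α.comp p) (hα.comp fun x => ⟨i x, hpi x⟩)
    rw [nonvanishingAlexander_one_iff] at h' ⊢
    intro f hf
    obtain ⟨c, hc⟩ := h' (fun g => f (p g)) (fun g k q => by
      simpa using hf (p g) (p k) q)
    refine ⟨c, fun x q => ?_⟩
    simpa [hpi] using hc (i x) q
  · intro h Q _ _ α hα
    -- The restriction of α to H need not be onto Q. Over its image, functions on Q are treated one
    -- left coset at a time, translated by a base point q.
    have h' := h (α.comp i).range (α.comp i).rangeRestrict (MonoidHom.rangeRestrict_surjective _)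
    rw [nonvanishingAlexander_one_iff] at h' ⊢
    intro f hf
    have hres : ∀ q : Q, IsTwistedCocycle R ψ (α.comp i).rangeRestrict
        fun x y => f (i x) (q * y) := by
      intro q x x' y
      simpa [hpi, mul_assoc] using hf (i x) (i x') (q * y)
    choose c hc using fun q => h' _ (hres q)
    -- The cochains for different base points in one coset need not match. Only their values at 1
    -- matter, since the corrected cocycle has to vanish only on the elements of H with trivial
    -- image in Q.
    refine ⟨fun q => c q 1, fun g q => sub_eq_zero.1 ?_⟩
    refine (hf.sub_coboundary fun q => c q 1).eq_zero i ?_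
      (exists_mul_eq_mul_of_commute hcomm hij) (fun k q hk => ?_) g q
    · have : (ψ.comp p).comp i = ψ := by ext x; simp [hpi]
      rwa [this]
    · have h1 := hc q k 1
      have h2 : (α.comp i).rangeRestrict k = 1 := Subtype.ext hk
      simp only [h2, OneMemClass.coe_one, mul_one] at h1
      simp only [h1, hk, mul_one, MonoidHom.comp_apply, hpi, sub_self]

/-- The monoid of the pullback projects onto that of ψ, and conversely each of its elements is a
product of one from the monoid of ψ and one from L, which has height 0 and is of type FP_1. -/
theorem isFP_one_nonnegMonoid_comp_iff [Group.FG L] (hij : ∀ g, ∃ h l, g = i h * j l)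
    (hpi : ∀ h, p (i h) = h) (hpj : ∀ l, p (j l) = 1) (ψ : H →* Multiplicative ℤ) :
    IsFP R (nonnegMonoid (ψ.comp p)) 1 ↔ IsFP R (nonnegMonoid ψ) 1 := by
  have hi : ∀ x : nonnegMonoid ψ, i x ∈ nonnegMonoid (ψ.comp p) := fun x => by
    rw [mem_nonnegMonoid, MonoidHom.comp_apply, hpi]; exact x.2
  have hj : ∀ l, j l ∈ nonnegMonoid (ψ.comp p) := fun l => by
    rw [mem_nonnegMonoid, MonoidHom.comp_apply, hpj, map_one]; rfl
  constructor
  · refine IsFP.of_surjective ((p.comp (nonnegMonoid (ψ.comp p)).subtype).codRestrict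
      (nonnegMonoid ψ) fun x => x.2) fun x => ⟨⟨i x, hi x⟩, Subtype.ext (hpi x)⟩
  · intro h
    refine IsFP.of_mul ((i.comp (nonnegMonoid ψ).subtype).codRestrict (nonnegMonoid (ψ.comp p)) hi)
      (j.codRestrict (nonnegMonoid (ψ.comp p)) hj) ?_ h (isFP_one_of_fg L)
    rintro ⟨g, hg⟩
    obtain ⟨x, l, rfl⟩ := hij g
    refine ⟨⟨x, ?_⟩, l, rfl⟩
    rw [mem_nonnegMonoid, MonoidHom.comp_apply, map_mul, hpi, hpj, mul_one] at hg
    exact hg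

theorem isSemiFibred_comp_iff [Group.FG L] (hij : ∀ g, ∃ h l, g = i h * j l)
    (hpi : ∀ h, p (i h) = h) (hpj : ∀ l, p (j l) = 1) (ψ : H →* Multiplicative ℤ) :
    IsSemiFibred R 1 (ψ.comp p) ↔ IsSemiFibred R 1 ψ := by
  -- Stated for all ψ because it is also needed for ψ⁻¹, whose pullback is the inverse of the
  -- pullback of ψ.
  have key : ∀ ψ : H →* Multiplicative ℤ,
      ψ.comp p ∈ bnsInvariant R G 1 ↔ ψ ∈ bnsInvariant R H 1 := by
    intro ψ
    refine and_congr (not_congr ⟨fun h => ?_, fun h => ?_⟩)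
      (isFP_one_nonnegMonoid_comp_iff hij hpi hpj ψ)
    · ext x
      simpa [hpi] using DFunLike.congr_fun h (i x)
    · rw [h, MonoidHom.one_comp]
  exact or_congr (key ψ) (key ψ⁻¹)

theorem forall_nonvanishing_iff [IsDomain R] (φ : G →* Multiplicative ℤ) (hφ : φ ≠ 1) :
    (∀ n, n ≤ 1 → NonvanishingTwistedAlexander R φ n) ↔ NonvanishingTwistedAlexander R φ 1 := by
  refine ⟨fun h => h 1 le_rfl, fun h n hn => ?_⟩
  interval_cases n
  · exact fun Q _ _ α _ => nonvanishingAlexander_zero φ α hφ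
  · exact h

theorem isSemiFibred_comp_iff_nonvanishing [IsDomain R] [Group.FG L]
    (hcomm : ∀ h l, Commute (i h) (j l)) (hij : ∀ g, ∃ h l, g = i h * j l)
    (hpi : ∀ h, p (i h) = h) (hpj : ∀ l, p (j l) = 1) (hH : IsTAP R H 1)
    (ψ : H →* Multiplicative ℤ) (hψ : ψ ≠ 1) :
    IsSemiFibred R 1 (ψ.comp p) ↔ NonvanishingTwistedAlexander R (ψ.comp p) 1 := by
  rw [isSemiFibred_comp_iff hij hpi hpj, nonvanishingTwistedAlexander_one_comp_iff hcomm hij hpi _ hψ,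
    hH.2 ψ hψ, forall_nonvanishing_iff ψ hψ]

end Product

end TAP

/-! ### The case distinction on the two restrictions of φ -/

theorem mainTheorem12 (R : Type u) [CommRing R] [IsDomain R]
    (G₁ G₂ : Type u) [Group G₁] [Group G₂] (hfg₁ : Group.FG G₁) (hfg₂ : Group.FG G₂)
    (h₁ : TAP.IsTAP R G₁ 1) (h₂ : TAP.IsTAP R G₂ 1) :
    TAP.IsTAP R (G₁ × G₂) 1 := by
  refine ⟨TAP.isFP_one_of_fg _, fun φ hφ => ?_⟩
  have hc₁ : ∀ x y, Commute (MonoidHom.inl G₁ G₂ x) (MonoidHom.inr G₁ G₂ y) :=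
    fun x y => MonoidHom.commute_inl_inr x y
  have hc₂ : ∀ y x, Commute (MonoidHom.inr G₁ G₂ y) (MonoidHom.inl G₁ G₂ x) :=
    fun y x => (hc₁ x y).symm
  have hd₁ : ∀ g, ∃ x y, g = MonoidHom.inl G₁ G₂ x * MonoidHom.inr G₁ G₂ y :=
    fun g => ⟨g.1, g.2, by simp⟩
  have hd₂ : ∀ g, ∃ y x, g = MonoidHom.inr G₁ G₂ y * MonoidHom.inl G₁ G₂ x :=
    fun g => ⟨g.2, g.1, by simp⟩
  have hφmul : ∀ g, φ g = φ (MonoidHom.inl G₁ G₂ g.1) * φ (MonoidHom.inr G₁ G₂ g.2) :=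
    fun g => by rw [← map_mul]; simp
  rw [TAP.forall_nonvanishing_iff φ hφ]
  by_cases hr : φ.comp (MonoidHom.inr G₁ G₂) = 1
  · have e : φ = (φ.comp (MonoidHom.inl G₁ G₂)).comp (MonoidHom.fst G₁ G₂) := by
      refine MonoidHom.ext fun g => ?_
      rw [hφmul, show φ (MonoidHom.inr G₁ G₂ g.2) = 1 from DFunLike.congr_fun hr g.2, mul_one]
      rfl
    have hl : φ.comp (MonoidHom.inl G₁ G₂) ≠ 1 := fun h => hφ (by rw [e, h, MonoidHom.one_comp])
    rw [e]
    exact TAP.isSemiFibred_comp_iff_nonvanishing hc₁ hd₁ (fun _ => rfl) (fun _ => rfl) h₁ _ hl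
  by_cases hl : φ.comp (MonoidHom.inl G₁ G₂) = 1
  · have e : φ = (φ.comp (MonoidHom.inr G₁ G₂)).comp (MonoidHom.snd G₁ G₂) := by
      refine MonoidHom.ext fun g => ?_
      rw [hφmul, show φ (MonoidHom.inl G₁ G₂ g.1) = 1 from DFunLike.congr_fun hl g.1, one_mul]
      rfl
    rw [e]
    exact TAP.isSemiFibred_comp_iff_nonvanishing hc₂ hd₂ (fun _ => rfl) (fun _ => rfl) h₂ _ hr
  -- With both restrictions non-trivial, φ itself lies in Σ¹ and its Alexander modules are torsion,
  -- so the equivalence holds without the TAP hypotheses.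
  · exact iff_of_true
      (Or.inl ⟨hφ, TAP.isFP_one_nonnegMonoid_of_commute _ _ hc₁ hd₁ φ hl hr⟩)
      (TAP.nonvanishingTwistedAlexander_one_of_commute hc₁ hd₁ φ hl hr)
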